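/- Let $\mathfrak c$ be the cardinality of the continuum, and regard $\mathbb C^{\mathbb C}$, the set of all functions $\mathbb C\to\mathbb C$, as a commutative algebra over $\mathbb C$ with pointwise operations. For a cardinal $\kappa$, a set $E\subset\mathbb C^{\mathbb C}$ is called strongly $\kappa$-algebrable if $E\cup\{0\}$ contains a free subalgebra with $\kappa$ generators; that is, there is a set $X\subset\mathbb C^{\mathbb C}$ of cardinality $\kappa$ such that $P(x_1,\dots,x_n)\neq 0$ for every $n\ge 1$, all distinct $x_1,\dots,x_n\in X$ and every nonzero complex polynomial $P$ in $n$ variables without constant term, and such that the (not necessarily unital) subalgebra generated by $X$ is contained in $E\cup\{0\}$. A function $f:\mathbb C\to\mathbb C$ is strongly everywhere surjective if $|\{x\in U: f(x)=z\}|=\mathfrak c$ for every nonempty open $U\subset\mathbb C$ and every $z\in\mathbb C$. It has the Baire property if $f^{-1}(U)$ has the Baire property (differs from an open set by a meager set) for every open $U\subset\mathbb C$. It is Lebesgue measurable if the preimage of every Borel set is Lebesgue measurable. It is $s$-measurable if $f^{-1}(U)\in s(\mathbb C)$ for every open $U\subset\mathbb C$, where $s(\mathbb C)$ is the Marczewski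 $\sigma$-algebra of all $A\subset\mathbb C$ such that every nonempty perfect set $P\subset\mathbb C$ contains a nonempty perfect set $Q$ with $Q\subset A\cap P$ or $Q\subset P\setminus A$. Let $\mathcal G_1$ be the set of all strongly everywhere surjective functions $f:\mathbb C\to\mathbb C$ which have the Baire property but are neither Lebesgue measurable nor $s$-measurable. Let $\mathcal G_2$ be the set of all strongly everywhere surjective functions $f:\mathbb C\to\mathbb C$ which are Lebesgue measurable but neither have the Baire property nor are $s$-measurable. Theorem. Both $\mathcal G_1$ and $\mathcal G_2$ are strongly $2^{\mathfrak c}$-algebrable. -/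

import Mathlib

open Cardinal MeasureTheory Topology

/-- A set `X` in a commutative `K`-algebra `A` is a set of free generators (of the subalgebra,
not necessarily with unit, which it generates): no nonzero polynomial without constant term,
with variables from `X`, vanishes when its variables are replaced by the elements of `X`. -/
def IsFreeGeneratingSet (K : Type*) {A : Type*} [Field K] [CommRing A] [Algebra K A]
    (X : Set A) : Prop :=
  ∀ P : MvPolynomial X K, MvPolynomial.constantCoeff P = 0 → P ≠ 0 →
    MvPolynomial.aeval (fun x : X => (x : A)) P ≠ 0

/-- `E` is strongly `κ`-algebrable: `E ∪ {0}` contains a free (commutative, not necessarily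
unital) algebra with `κ` generators. -/
def StronglyAlgebrable (K : Type*) {A : Type*} [Field K] [CommRing A] [Algebra K A]
    (κ : Cardinal) (E : Set A) : Prop :=
  ∃ B : NonUnitalSubalgebra K A, (B : Set A) ⊆ E ∪ {0} ∧
    ∃ X : Set A, #X = κ ∧ IsFreeGeneratingSet K X ∧ NonUnitalAlgebra.adjoin K X = B

/-- `f` takes every value `𝔠` many times on every nonempty open set. -/
def StronglyEverywhereSurjective (f : ℂ → ℂ) : Prop :=
  ∀ U : Set ℂ, IsOpen U → U.Nonempty → ∀ z : ℂ, #{x : ℂ | x ∈ U ∧ f x = z} = 𝔠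

/-- The function `f` has the Baire property. -/
def HasBaireProperty {X Y : Type*} [TopologicalSpace X] [TopologicalSpace Y] (f : X → Y) : Prop :=
  ∀ U : Set Y, IsOpen U → BaireMeasurableSet (f ⁻¹' U)

/-- Membership of `A` in the Marczewski σ-algebra `s(X)`. -/
def MarczewskiSet {X : Type*} [TopologicalSpace X] (A : Set X) : Prop :=
  ∀ P : Set X, Perfect P → P.Nonempty →
    ∃ Q : Set X, Perfect Q ∧ Q.Nonempty ∧ Q ⊆ P ∧ (Q ⊆ A ∩ P ∨ Q ⊆ P \ A)

/-- The function `f` is `s(X)`-measurable. -/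
def SMeasurable {X Y : Type*} [TopologicalSpace X] [TopologicalSpace Y] (f : X → Y) : Prop :=
  ∀ U : Set Y, IsOpen U → MarczewskiSet (f ⁻¹' U)

/-- Strongly everywhere surjective functions with the Baire property that are neither Lebesgue
measurable nor `s`-measurable. `NullMeasurable f volume` says that preimages of Borel sets are
Lebesgue measurable, i.e. belong to the completion of the Borel σ-algebra. -/
def familyG₁ : Set (ℂ → ℂ) :=
  {f | StronglyEverywhereSurjective f ∧ HasBaireProperty f ∧
    ¬ NullMeasurable f volume ∧ ¬ SMeasurable f}

/-- Strongly everywhere surjective functions that are Lebesgue measurable and neither have the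
Baire property nor are `s`-measurable. -/
def familyG₂ : Set (ℂ → ℂ) :=
  {f | StronglyEverywhereSurjective f ∧ NullMeasurable f volume ∧
    ¬ HasBaireProperty f ∧ ¬ SMeasurable f}

/-!
By transfinite induction there is a map `b` which takes each of `𝔠` values `𝔠` times on every
nonempty perfect set, and this property survives composition with a surjection. For functions
`h ξ` of an independent family indexed by `2 ^ 𝔠`, the joint values at finitely many indices are
arbitrary, and over an algebraically closed field a nonzero polynomial without constant term is
surjective. So every such polynomial in the functions `h ξ` is a surjection `φ`, and its value at
the generators `M.indicator (h ξ ∘ b)` is `M.indicator (φ ∘ b)`, where `φ ∘ b` is again of the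
same kind as `b`.

If `M` is conull and meagre, this function vanishes off a meagre set, so it has the Baire property.
It is not Lebesgue measurable, since an uncountable Borel set contains a nonempty perfect set and
so meets all fibres of `φ ∘ b`. If `M` is null and comeagre, the two notions exchange their
roles. In both cases the function takes every value on every nonempty perfect subset of `M`, and
hence is not `s`-measurable.
-/

universe u

theorem exists_injective_choice {ι α : Type u} (S : ι → Set α) (hS : ∀ i, #ι ≤ #(S i)) :
    ∃ x : ι → α, Function.Injective x ∧ ∀ i, x i ∈ S i := by
  -- Enumerate `ι` in order type `(#ι).ord`: fewer than `#ι` points are used up before each stage.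
  obtain ⟨r, wo, hr⟩ := Cardinal.exists_ord_eq ι
  have exists_unused (i : ι) (y : {j // r j i} → α) : (S i \ Set.range y).Nonempty := by
    by_contra hempty
    rw [Set.not_nonempty_iff_eq_empty, Set.sdiff_eq_empty] at hempty
    have hlt : #{j // r j i} < #ι := by
      simpa only [Ordinal.card_typein] using Cardinal.card_typein_lt i hr
    exact hlt.not_ge <| (hS i).trans <| (Cardinal.mk_le_mk_of_subset hempty).trans mk_range_le
  let x : ι → α := wo.wf.fix fun i y => (exists_unused i fun j => y j.1 j.2).some
  have hx (i : ι) : x i ∈ S i \ Set.range fun j : {j // r j i} => x j := by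
    rw [show x i = (exists_unused i fun j => x j).some from wo.wf.fix_eq _ i]
    exact (exists_unused i fun j => x j).some_mem
  have hne {i j : ι} (hij : r i j) : x i ≠ x j := fun h => (hx j).2 ⟨⟨i, hij⟩, h⟩
  refine ⟨x, fun i j hij => ?_, fun i => (hx i).1⟩
  rcases trichotomous_of r i j with h | h | h
  · exact absurd hij (hne h)
  · exact h
  · exact absurd hij.symm (hne h)

theorem mk_measurableSet_le_continuum (α : Type u) [TopologicalSpace α]
    [SecondCountableTopology α] [MeasurableSpace α] [BorelSpace α] :
    #{s : Set α // MeasurableSet s} ≤ 𝔠 := by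
  rw [BorelSpace.measurable_eq (α := α),
    (TopologicalSpace.isBasis_countableBasis α).borel_eq_generateFrom]
  exact MeasurableSpace.cardinal_measurableSet_le_continuum <|
    (TopologicalSpace.countable_countableBasis α).le_aleph0.trans aleph0_le_continuum

theorem mk_le_continuum_of_secondCountable_t1 (α : Type u) [TopologicalSpace α]
    [SecondCountableTopology α] [T1Space α] : #α ≤ 𝔠 := by
  borelize α
  refine le_trans ?_ (mk_measurableSet_le_continuum α)
  exact mk_le_of_injective (f := fun x => ⟨{x}, measurableSet_singleton x⟩)
    fun x y h => Set.singleton_injective (congrArg Subtype.val h)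

theorem continuum_le_mk_of_perfect {α : Type u} [TopologicalSpace α] [PolishSpace α] {Q : Set α}
    (hQ : Perfect Q) (hne : Q.Nonempty) : 𝔠 ≤ #Q := by
  let := TopologicalSpace.upgradeIsCompletelyMetrizable α
  obtain ⟨f, hfQ, -, hf⟩ := hQ.exists_nat_bool_injection hne
  simpa using lift_mk_le_lift_mk_of_injective (f := Set.codRestrict f Q fun x => hfQ ⟨x, rfl⟩)
    (hf.codRestrict _)

theorem exists_nat_bool_injection_of_measurableSet {α : Type*} [TopologicalSpace α]
    [PolishSpace α] [MeasurableSpace α] [BorelSpace α] {s : Set α} (hs : MeasurableSet s)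
    (hunc : ¬ s.Countable) :
    ∃ f : (ℕ → Bool) → α, Set.range f ⊆ s ∧ Continuous f ∧ Function.Injective f := by
  -- `s` becomes closed in some finer Polish topology.
  obtain ⟨τ, hle, hpolish, hclosed, -⟩ := hs.isClopenable
  obtain ⟨f, hfs, hf, hinj⟩ :=
    @IsClosed.exists_nat_bool_injection_of_not_countable α τ hpolish s hclosed hunc
  exact ⟨f, hfs, continuous_le_rng hle hf, hinj⟩

theorem exists_perfect_subset_of_measurableSet {α : Type*} [TopologicalSpace α]
    [PolishSpace α] [MeasurableSpace α] [BorelSpace α] {s : Set α} (hs : MeasurableSet s)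
    (hunc : ¬ s.Countable) : ∃ Q ⊆ s, Perfect Q ∧ Q.Nonempty := by
  obtain ⟨f, hfs, hf, hinj⟩ := exists_nat_bool_injection_of_measurableSet hs hunc
  have : Uncountable (ℕ → Bool) := aleph0_lt_mk_iff.1 (by simp [aleph0_lt_continuum])
  have hrange : ¬ (Set.range f).Countable := fun h => Set.not_countable_univ <|
    Set.countable_of_injective_of_countable_image hinj.injOn (by rwa [Set.image_univ])
  obtain ⟨Q, hQ, hne, hQf⟩ := exists_perfect_nonempty_of_isClosed_of_not_countable
    (isCompact_range hf).isClosed hrange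
  exact ⟨Q, hQf.trans hfs, hQ, hne⟩

/-- The analogue of `StronglyEverywhereSurjective` for maps between arbitrary spaces. -/
def EverywhereContinuumToOne {α β : Type*} [TopologicalSpace α] (f : α → β) : Prop :=
  ∀ U : Set α, IsOpen U → U.Nonempty → ∀ z, #{x | x ∈ U ∧ f x = z} = 𝔠

/-- A Bernstein map takes every value `𝔠` many times on every nonempty perfect set. It is the
analogue for functions of the partition of a space into Bernstein sets. -/
def IsBernsteinMap {α T : Type*} [TopologicalSpace α] (b : α → T) : Prop :=
  ∀ Q : Set α, Perfect Q → Q.Nonempty → ∀ t, 𝔠 ≤ #↥(Q ∩ b ⁻¹' {t})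

theorem exists_isBernsteinMap (α : Type u) {T : Type u} [TopologicalSpace α] [PolishSpace α]
    [Nonempty T] (hT : #T ≤ 𝔠) : ∃ b : α → T, IsBernsteinMap b := by
  let ι := {Q : Set α // Perfect Q ∧ Q.Nonempty} × T × (𝔠 : Cardinal.{u}).out
  have hι : #ι ≤ 𝔠 := by
    borelize α
    have hperfect : #{Q : Set α // Perfect Q ∧ Q.Nonempty} ≤ 𝔠 :=
      (mk_subtype_mono fun Q hQ => hQ.1.closed.measurableSet).trans
        (mk_measurableSet_le_continuum α)
    simp only [ι, mk_prod, lift_id, mk_out]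
    exact (mul_le_mul' hperfect (mul_le_mul' hT le_rfl)).trans (by simp)
  obtain ⟨x, hinj, hx⟩ := exists_injective_choice (fun i : ι => i.1.1)
    fun i => hι.trans (continuum_le_mk_of_perfect i.1.2.1 i.1.2.2)
  let b := Function.extend x (fun i => i.2.1) fun _ => Classical.arbitrary T
  refine ⟨b, fun Q hQ hne t => ?_⟩
  let point (c : (𝔠 : Cardinal.{u}).out) : ↥(Q ∩ b ⁻¹' {t}) :=
    ⟨x (⟨Q, hQ, hne⟩, t, c), hx (⟨Q, hQ, hne⟩, t, c), hinj.extend_apply _ _ _⟩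
  have point_injective : Function.Injective point := fun c c' h =>
    congrArg (·.2.2) (hinj (congrArg Subtype.val h))
  simpa only [mk_out] using mk_le_of_injective point_injective

namespace IsBernsteinMap

variable {α : Type u} {T : Type*} [TopologicalSpace α] {b : α → T}

theorem exists_mem_eq (hb : IsBernsteinMap b) {Q : Set α} (hQ : Perfect Q) (hne : Q.Nonempty)
    (t : T) : ∃ x ∈ Q, b x = t :=
  Set.nonempty_coe_sort.1 <| mk_ne_zero_iff.1 (continuum_pos.trans_le (hb Q hQ hne t)).ne'

theorem surjective_comp {K : Type*} {φ : T → K} (hb : IsBernsteinMap b)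
    (hφ : Function.Surjective φ) : IsBernsteinMap (φ ∘ b) := by
  intro Q hQ hne z
  obtain ⟨t, rfl⟩ := hφ z
  exact (hb Q hQ hne t).trans <| mk_le_mk_of_subset fun x hx => ⟨hx.1, congrArg φ hx.2⟩

variable [PolishSpace α] [MeasurableSpace α] [BorelSpace α]

theorem continuum_le_mk_inter_preimage (hb : IsBernsteinMap b) {s : Set α} (hs : MeasurableSet s)
    (hunc : ¬ s.Countable) (t : T) : 𝔠 ≤ #↥(s ∩ b ⁻¹' {t}) := by
  obtain ⟨Q, hQs, hQ, hne⟩ := exists_perfect_subset_of_measurableSet hs hunc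
  exact (hb Q hQ hne t).trans <| mk_le_mk_of_subset <| Set.inter_subset_inter_left _ hQs

theorem countable_of_forall_ne (hb : IsBernsteinMap b) {s : Set α} (hs : MeasurableSet s)
    {t : T} (ht : ∀ x ∈ s, b x ≠ t) : s.Countable := by
  by_contra hunc
  obtain ⟨Q, hQs, hQ, hne⟩ := exists_perfect_subset_of_measurableSet hs hunc
  obtain ⟨x, hxQ, hx⟩ := hb.exists_mem_eq hQ hne t
  exact ht x (hQs hxQ) hx

theorem not_eventuallyMeasurableSet_preimage (hb : IsBernsteinMap b) {l : Filter α} [l.NeBot]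
    [CountableInterFilter l] [l.IsMeasurablyGenerated] (hl : l ≤ Filter.cocountable) {S : Set T}
    (hS : S.Nonempty) (hSc : Sᶜ.Nonempty) :
    ¬ EventuallyMeasurableSet ‹_› l (b ⁻¹' S) := by
  rintro ⟨B, hB, hbB⟩
  obtain ⟨G, hGl, hG, hGB⟩ := Filter.IsMeasurablyGenerated.exists_measurable_subset hbB.mem_iff
  obtain ⟨t, ht⟩ := hS
  obtain ⟨t', ht'⟩ := hSc
  have hinter : (G ∩ B).Countable := hb.countable_of_forall_ne (hG.inter hB) (t := t')
    fun x hx hxt => ht' (hxt ▸ (hGB hx.1).2 hx.2)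
  have hdiff : (G \ B).Countable := hb.countable_of_forall_ne (hG.diff hB) (t := t)
    fun x hx hxt => hx.2 ((hGB hx.1).1 (by rwa [Set.mem_preimage, hxt]))
  have hGc : Gᶜ ∈ l := hl <| Filter.mem_cocountable.2 <| by
    rw [compl_compl, ← Set.inter_union_sdiff G B]
    exact hinter.union hdiff
  exact l.empty_notMem (by simpa using Filter.inter_mem hGl hGc)

variable [Zero T] {M : Set α}

theorem everywhereContinuumToOne_indicator (hb : IsBernsteinMap b) (hM : MeasurableSet M)
    (hMU : ∀ U : Set α, IsOpen U → U.Nonempty → ¬ (M ∩ U).Countable) :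
    EverywhereContinuumToOne (M.indicator b) := by
  intro U hU hne z
  refine le_antisymm ((mk_set_le _).trans (mk_le_continuum_of_secondCountable_t1 α)) ?_
  refine (hb.continuum_le_mk_inter_preimage (hM.inter hU.measurableSet) (hMU U hU hne) z).trans ?_
  exact mk_le_mk_of_subset fun x hx => ⟨hx.1.2, (Set.indicator_of_mem hx.1.1 b).trans hx.2⟩

theorem not_sMeasurable_indicator [TopologicalSpace T] [T1Space T] [Nontrivial T]
    (hb : IsBernsteinMap b) (hM : MeasurableSet M) (hunc : ¬ M.Countable) :
    ¬ SMeasurable (M.indicator b) := by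
  intro hs
  obtain ⟨P, hPM, hP, hPne⟩ := exists_perfect_subset_of_measurableSet hM hunc
  obtain ⟨Q, hQ, hQne, hQP, hQsub⟩ := hs {0}ᶜ isOpen_compl_singleton P hP hPne
  have exists_indicator_eq (z : T) : ∃ x ∈ Q, M.indicator b x = z := by
    obtain ⟨x, hxQ, hx⟩ := hb.exists_mem_eq hQ hQne z
    exact ⟨x, hxQ, (Set.indicator_of_mem (hPM (hQP hxQ)) b).trans hx⟩
  rcases hQsub with hQsub | hQsub
  · obtain ⟨x, hxQ, hx⟩ := exists_indicator_eq 0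
    exact (hQsub hxQ).1 hx
  · obtain ⟨z, hz⟩ := exists_ne (0 : T)
    obtain ⟨x, hxQ, rfl⟩ := exists_indicator_eq z
    exact (hQsub hxQ).2 hz

theorem not_eventuallyMeasurableSet_indicator_preimage [Nontrivial T] (hb : IsBernsteinMap b)
    {l : Filter α} [l.NeBot] [CountableInterFilter l] [l.IsMeasurablyGenerated]
    (hl : l ≤ Filter.cocountable) (hM : M ∈ l) :
    ¬ EventuallyMeasurableSet ‹_› l (M.indicator b ⁻¹' {0}ᶜ) := by
  have hbM : b =ᶠ[l] M.indicator b :=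
    Filter.mem_of_superset hM fun x hx => (Set.indicator_of_mem hx b).symm
  exact fun h => hb.not_eventuallyMeasurableSet_preimage hl (exists_ne 0) ⟨0, not_not.2 rfl⟩
    (h.congr (hbM.preimage _))

end IsBernsteinMap

/-- A family of functions is finitely independent if any finitely many of its members take
arbitrary prescribed values at a common point. For `{0, 1}`-valued functions these are the
independent families of sets of Fichtenholz, Kantorovich and Hausdorff. -/
def FinitelyIndependent {ι T K : Type*} (h : ι → T → K) : Prop :=
  ∀ (F : Finset ι) (w : ι → K), ∃ t, ∀ i ∈ F, h i t = w i

section TraceValue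

open Classical in
/-- The independent family of Hausdorff: a point of its domain is a finite set `A ⊆ I` together
with a table of values indexed by the subsets of `A` (encoded as a finitely supported function),
and the function with index `ξ` looks up the value at the trace `A ∩ ξ`. -/
noncomputable def traceValue {I K : Type*} [Zero K] (ξ : Set I)
    (t : Finset I × (Finset I →₀ K)) : K :=
  t.2 (t.1.filter (· ∈ ξ))

open Classical in
theorem exists_finset_injOn_filter_mem {I : Type*} (F : Finset (Set I)) :
    ∃ A : Finset I, Set.InjOn (fun ξ : Set I => A.filter (· ∈ ξ)) F := by
  refine Filter.Eventually.exists (f := Filter.atTop) ?_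
  simp only [Set.InjOn, Finset.mem_coe, Filter.eventually_all_finset]
  intro ξ _ η _
  rcases eq_or_ne ξ η with rfl | hne
  · exact .of_forall fun _ _ => rfl
  · obtain ⟨x, hx⟩ : ∃ x, ¬ (x ∈ ξ ↔ x ∈ η) := by
      by_contra! h
      exact hne (Set.ext h)
    filter_upwards [Filter.eventually_ge_atTop {x}] with A hA htrace
    have hxA : x ∈ A := hA (Finset.mem_singleton_self x)
    have := congrArg (x ∈ ·) htrace
    simp only [Finset.mem_filter, hxA, true_and, eq_iff_iff] at this
    exact absurd this hx

theorem finitelyIndependent_traceValue {I K : Type*} [AddCommMonoid K] :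
    FinitelyIndependent (traceValue : Set I → Finset I × (Finset I →₀ K) → K) := by
  classical
  intro F w
  obtain ⟨A, hA⟩ := exists_finset_injOn_filter_mem F
  let table := Finsupp.indicator F fun ξ _ => w ξ
  refine ⟨(A, table.mapDomain fun ξ => A.filter (· ∈ ξ)), fun ξ hξ => ?_⟩
  calc table.mapDomain (fun ξ => A.filter (· ∈ ξ)) (A.filter (· ∈ ξ))
    _ = table ξ := Finsupp.mapDomain_apply' F table (Finsupp.support_indicator_subset F _) hA hξ
    _ = w ξ := Finsupp.indicator_of_mem hξ _

end TraceValue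

open MvPolynomial

theorem aeval_pi_apply {R σ T : Type*} [CommSemiring R] (h : σ → T → R) (P : MvPolynomial σ R)
    (t : T) : aeval h P t = eval (fun i => h i t) P :=
  map_aeval h (Pi.evalRingHom (fun _ : T => R) t) P

theorem aeval_indicator_comp {R σ α T : Type*} [CommSemiring R] (M : Set α) (h : σ → T → R)
    (b : α → T) {P : MvPolynomial σ R} (hP : constantCoeff P = 0) :
    aeval (fun i => M.indicator (h i ∘ b)) P = M.indicator (aeval h P ∘ b) := by
  funext x
  by_cases hx : x ∈ M
  · simp [aeval_pi_apply, hx]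
  · simp [aeval_pi_apply, hx, hP]

theorem surjective_eval_of_constantCoeff_eq_zero {K σ : Type*} [Field K] [IsAlgClosed K]
    {P : MvPolynomial σ K} (hP₀ : constantCoeff P = 0) (hP : P ≠ 0) :
    Function.Surjective fun w : σ → K => eval w P := by
  -- `P` is nonconstant on the line through `0` and a point `a` where it does not vanish.
  have : Infinite K := IsAlgClosed.instInfinite
  obtain ⟨a, ha⟩ : ∃ a, eval a P ≠ 0 := by
    by_contra! h
    exact hP (MvPolynomial.funext fun x => by simpa using h x)
  let q : Polynomial K := aeval (fun i => Polynomial.X * Polynomial.C (a i)) P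
  have hq (t : K) : q.eval t = eval (fun i => t * a i) P := by
    rw [← Polynomial.coe_aeval_eq_eval, comp_aeval_apply, ← aeval_eq_eval]
    simp only [map_mul, Polynomial.aeval_X, Polynomial.aeval_C, Algebra.algebraMap_self_apply]
  have hdeg : q.natDegree ≠ 0 := by
    intro hdeg
    rw [Polynomial.natDegree_eq_zero] at hdeg
    obtain ⟨c, hc⟩ := hdeg
    have h0 : c = 0 := by simpa [← hc, hP₀] using hq 0
    have h1 : c = eval a P := by simpa [← hc] using hq 1
    exact ha (h1 ▸ h0)
  intro z
  obtain ⟨t, rfl⟩ := IsAlgClosed.eval_surjective hdeg z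
  exact ⟨fun i => t * a i, (hq t).symm⟩

theorem FinitelyIndependent.surjective_aeval {ι T K : Type*} [Field K] [IsAlgClosed K]
    {h : ι → T → K} (hh : FinitelyIndependent h) {P : MvPolynomial ι K}
    (hP₀ : constantCoeff P = 0) (hP : P ≠ 0) : Function.Surjective (aeval h P) := by
  intro z
  obtain ⟨w, rfl⟩ := surjective_eval_of_constantCoeff_eq_zero hP₀ hP z
  obtain ⟨t, ht⟩ := hh P.vars w
  refine ⟨t, ?_⟩
  rw [aeval_pi_apply]
  exact eval₂Hom_congr' rfl (fun i hi _ => ht i hi) rfl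

theorem exists_aeval_eq_of_mem_adjoin_range {R A ι : Type*} [CommRing R] [CommRing A] [Algebra R A]
    {g : ι → A} {a : A} (ha : a ∈ NonUnitalAlgebra.adjoin R (Set.range g)) :
    ∃ P : MvPolynomial ι R, constantCoeff P = 0 ∧ aeval g P = a := by
  induction ha using NonUnitalAlgebra.adjoin_induction with
  | mem x hx =>
    obtain ⟨i, rfl⟩ := hx
    exact ⟨X i, constantCoeff_X R i, aeval_X g i⟩
  | zero => exact ⟨0, map_zero _, map_zero _⟩
  | add x y _ _ hx hy =>
    obtain ⟨P, hP, rfl⟩ := hx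
    obtain ⟨Q, hQ, rfl⟩ := hy
    exact ⟨P + Q, by simp only [map_add, hP, hQ, add_zero], map_add _ _ _⟩
  | mul x y _ _ hx hy =>
    obtain ⟨P, hP, rfl⟩ := hx
    obtain ⟨Q, -, rfl⟩ := hy
    exact ⟨P * Q, by simp only [map_mul, hP, zero_mul], map_mul _ _ _⟩
  | smul r x _ hx =>
    obtain ⟨P, hP, rfl⟩ := hx
    exact ⟨r • P, by simp [hP], map_smul _ _ _⟩

namespace StronglyAlgebrable

variable {K : Type*} [Field K]

theorem mono {A : Type*} [CommRing A] [Algebra K A] {κ : Cardinal} {E E' : Set A}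
    (h : StronglyAlgebrable K κ E) (hE : E ⊆ E') : StronglyAlgebrable K κ E' := by
  obtain ⟨B, hB, hX⟩ := h
  exact ⟨B, hB.trans (Set.union_subset_union_left _ hE), hX⟩

theorem of_forall_aeval_mem {ι A : Type u} [CommRing A] [Algebra K A] (g : ι → A) {E : Set A}
    (h0 : 0 ∉ E)
    (hg : ∀ P : MvPolynomial ι K, constantCoeff P = 0 → P ≠ 0 → aeval g P ∈ E) :
    StronglyAlgebrable K #ι E := by
  have hinj : Function.Injective g := by
    intro i j hij
    by_contra hne
    have hX : (X i - X j : MvPolynomial ι K) ≠ 0 := sub_ne_zero.2 ((X_injective).ne hne)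
    exact h0 (by simpa [hij] using hg (X i - X j) (by simp) hX)
  let e : Set.range g ≃ ι := (Equiv.ofInjective g hinj).symm
  have hge : g ∘ e = Subtype.val := funext fun x => Equiv.apply_ofInjective_symm hinj x
  refine ⟨_, fun a ha => ?_, Set.range g, mk_range_eq g hinj, fun P hP₀ hP hzero => ?_, rfl⟩
  · obtain ⟨P, hP₀, rfl⟩ := exists_aeval_eq_of_mem_adjoin_range ha
    rcases eq_or_ne P 0 with rfl | hP
    · exact Or.inr (map_zero _)
    · exact Or.inl (hg P hP₀ hP)
  · refine h0 ?_
    have hrename : rename e P ≠ 0 := (map_ne_zero_iff _ (rename_injective e e.injective)).2 hP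
    simpa only [aeval_rename, hge, hzero] using hg (rename e P) (by simpa) hrename

end StronglyAlgebrable

theorem stronglyAlgebrable_of_indicator_mem {α K : Type u} [TopologicalSpace α] [PolishSpace α]
    [Field K] [IsAlgClosed K] (hK : #K ≤ 𝔠) {M : Set α} {E : Set (α → K)} (h0 : 0 ∉ E)
    (hE : ∀ b : α → K, IsBernsteinMap b → M.indicator b ∈ E) :
    StronglyAlgebrable K (2 ^ 𝔠) E := by
  let I := (𝔠 : Cardinal.{u}).out
  have hI : #I = 𝔠 := mk_out 𝔠
  have : Infinite I := infinite_iff.2 (hI ▸ aleph0_le_continuum)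
  have hT : #(Finset I × (Finset I →₀ K)) ≤ 𝔠 := by
    simp [hI, hK]
  obtain ⟨b, hb⟩ := exists_isBernsteinMap α hT
  rw [← hI, ← mk_set]
  refine .of_forall_aeval_mem (fun ξ => M.indicator (traceValue ξ ∘ b)) h0 fun P hP₀ hP => ?_
  rw [aeval_indicator_comp M _ b hP₀]
  exact hE _ (hb.surjective_comp (finitelyIndependent_traceValue.surjective_aeval hP₀ hP))

section Filters

variable {α : Type*}

theorem not_countable_inter_of_frequently {l : Filter α} (hl : l ≤ Filter.cocountable) {M U : Set α}
    (hM : M ∈ l) (hU : ∃ᶠ x in l, x ∈ U) : ¬ (M ∩ U).Countable := by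
  intro hcount
  refine hU ?_
  filter_upwards [hM, hl (Filter.mem_cocountable.2 (by rwa [compl_compl]))] with x hxM hx hxU
    using hx ⟨hxM, hxU⟩

theorem ae_le_cocountable [MeasurableSpace α] (μ : Measure α) [NullSingletonClass μ] :
    ae μ ≤ Filter.cocountable :=
  fun _ hs => mem_ae_iff.2 ((Filter.mem_cocountable.1 hs).measure_zero μ)

variable [TopologicalSpace α]

instance isMeasurablyGenerated_residual [MeasurableSpace α] [OpensMeasurableSpace α] :
    (residual α).IsMeasurablyGenerated where
  exists_measurable_subset s hs := by
    obtain ⟨S, hopen, hdense, hcount, hSs⟩ := mem_residual_iff.1 hs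
    exact ⟨⋂₀ S, mem_residual_iff.2 ⟨S, hopen, hdense, hcount, subset_rfl⟩,
      .sInter hcount fun t ht => (hopen t ht).measurableSet, hSs⟩

theorem residual_le_cocountable [T1Space α] [PerfectSpace α] :
    residual α ≤ Filter.cocountable := by
  intro s hs
  rw [← compl_compl s, ← Set.biUnion_of_singleton sᶜ, Set.compl_iUnion₂]
  refine (countable_bInter_mem (Filter.mem_cocountable.1 hs)).2 fun x _ => ?_
  have : (𝓝[≠] x).NeBot := perfectSpace_iff_forall_not_isolated.1 ‹_› x
  exact residual_of_dense_open isOpen_compl_singleton (dense_compl_singleton x)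

theorem frequently_residual_mem_of_isOpen [BaireSpace α] {U : Set α} (hU : IsOpen U)
    (hne : U.Nonempty) : ∃ᶠ x in residual α, x ∈ U :=
  not_isMeagre_of_isOpen hU hne

variable [MeasurableSpace α] (μ : Measure α)

theorem frequently_ae_mem_of_isOpen [μ.IsOpenPosMeasure] {U : Set α} (hU : IsOpen U)
    (hne : U.Nonempty) : ∃ᶠ x in ae μ, x ∈ U :=
  frequently_ae_mem_iff.2 (hU.measure_ne_zero μ hne)

theorem perfectSpace_of_nullSingletonClass [μ.IsOpenPosMeasure] [NullSingletonClass μ] :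
    PerfectSpace α := by
  refine perfectSpace_iff_forall_not_isolated.2 fun x => ?_
  rw [← mem_closure_iff_nhdsWithin_neBot]
  exact μ.dense_of_ae (ae_le_cocountable μ (by simp)) x

theorem disjoint_residual_ae [TopologicalSpace.SeparableSpace α] [μ.OuterRegular]
    [NullSingletonClass μ] : Disjoint (residual α) (ae μ) := by
  obtain ⟨D, hDc, hDd⟩ := TopologicalSpace.exists_countable_dense α
  have exists_isOpen (n : ℕ) : ∃ U ⊇ D, IsOpen U ∧ μ U < (n : ENNReal)⁻¹ :=
    D.exists_isOpen_lt_of_lt _ (by simp [hDc.measure_zero μ])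
  choose U hDU hUo hUn using exists_isOpen
  have hnull : μ (⋂ n, U n) = 0 := le_antisymm
    (ge_of_tendsto' ENNReal.tendsto_inv_nat_nhds_zero fun n =>
      (measure_mono (Set.iInter_subset U n)).trans (hUn n).le) zero_le
  refine Filter.disjoint_iff.2 ⟨⋂ n, U n, countable_iInter_mem.2 fun n => ?_,
    (⋂ n, U n)ᶜ, compl_mem_ae_iff.2 hnull, disjoint_compl_right⟩
  exact residual_of_dense_open (hUo n) (hDd.mono (hDU n))

end Filters

theorem HasBaireProperty.of_eventuallyEq_continuous {X Y : Type*} [TopologicalSpace X]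
    [TopologicalSpace Y] {f g : X → Y} (hg : Continuous g) (hfg : f =ᶠ[residual X] g) :
    HasBaireProperty f :=
  fun U hU => (hU.preimage hg).baireMeasurableSet.congr (hfg.symm.preimage U)

theorem stronglyAlgebrable_of_disjoint {α K : Type u} [TopologicalSpace α] [PolishSpace α]
    [MeasurableSpace α] [BorelSpace α] [Field K] [IsAlgClosed K] [TopologicalSpace K] [T1Space K]
    [Nonempty α] (hK : #K ≤ 𝔠) {l l' : Filter α} [CountableInterFilter l] [l.IsMeasurablyGenerated]
    (hl : l ≤ Filter.cocountable) (hopen : ∀ U : Set α, IsOpen U → U.Nonempty → ∃ᶠ x in l, x ∈ U)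
    (hdisj : Disjoint l l') :
    StronglyAlgebrable K (2 ^ 𝔠) {f : α → K | EverywhereContinuumToOne f ∧ f =ᶠ[l'] 0 ∧
      ¬ EventuallyMeasurableSet ‹_› l (f ⁻¹' {0}ᶜ) ∧ ¬ SMeasurable f} := by
  obtain ⟨s, hs, s', hs', hss'⟩ := Filter.disjoint_iff.1 hdisj
  obtain ⟨M, hMl, hM, hMs⟩ := Filter.IsMeasurablyGenerated.exists_measurable_subset hs
  have hfreq := hopen Set.univ isOpen_univ Set.univ_nonempty
  have : l.NeBot := Filter.frequently_true_iff_neBot l |>.1 (hfreq.mono fun _ _ => trivial)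
  have hunc : ¬ M.Countable := by
    simpa only [Set.inter_univ] using
      not_countable_inter_of_frequently hl hMl hfreq
  refine stronglyAlgebrable_of_indicator_mem hK (M := M) ?_ fun b hb => ⟨?_, ?_, ?_, ?_⟩
  · rintro ⟨-, -, h, -⟩
    exact h (MeasurableSet.const ((0 : K) ∈ ({0}ᶜ : Set K))).eventuallyMeasurableSet
  · exact hb.everywhereContinuumToOne_indicator hM fun U hU hne =>
      not_countable_inter_of_frequently hl hMl (hopen U hU hne)
  · filter_upwards [hs'] with x hx
    exact Set.indicator_of_notMem (fun hxM => hss'.notMem_of_mem_left (hMs hxM) hx) b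
  · exact hb.not_eventuallyMeasurableSet_indicator_preimage hl hMl
  · exact hb.not_sMeasurable_indicator hM hunc

theorem mainTheorem9_general {α K : Type u} [TopologicalSpace α] [PolishSpace α] [Nonempty α]
    [MeasurableSpace α] [BorelSpace α] (μ : Measure α) [NullSingletonClass μ] [μ.IsOpenPosMeasure]
    [μ.OuterRegular] [Field K] [IsAlgClosed K] [TopologicalSpace K] [T1Space K]
    [MeasurableSpace K] [MeasurableSingletonClass K] (hK : #K ≤ 𝔠) :
    StronglyAlgebrable K (2 ^ 𝔠) {f : α → K | EverywhereContinuumToOne f ∧ HasBaireProperty f ∧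
        ¬ NullMeasurable f μ ∧ ¬ SMeasurable f} ∧
      StronglyAlgebrable K (2 ^ 𝔠) {f : α → K | EverywhereContinuumToOne f ∧ NullMeasurable f μ ∧
        ¬ HasBaireProperty f ∧ ¬ SMeasurable f} := by
  have := perfectSpace_of_nullSingletonClass μ
  have hdisj := disjoint_residual_ae μ
  constructor
  · refine (stronglyAlgebrable_of_disjoint hK (ae_le_cocountable μ)
      (fun _ => frequently_ae_mem_of_isOpen μ) hdisj.symm).mono ?_
    rintro f ⟨hf, hf0, hfμ, hfs⟩
    exact ⟨hf, .of_eventuallyEq_continuous continuous_const hf0,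
      fun h => hfμ (h (measurableSet_singleton 0).compl), hfs⟩
  · refine (stronglyAlgebrable_of_disjoint hK residual_le_cocountable
      (fun _ => frequently_residual_mem_of_isOpen) hdisj).mono ?_
    rintro f ⟨hf, hf0, hfb, hfs⟩
    refine ⟨hf, measurable_const.nullMeasurable.congr hf0.symm, fun h => hfb ?_, hfs⟩
    rw [BorelSpace.measurable_eq (α := α)]
    exact h _ isOpen_compl_singleton

theorem mainTheorem9 :
    StronglyAlgebrable ℂ (2 ^ 𝔠) familyG₁ ∧ StronglyAlgebrable ℂ (2 ^ 𝔠) familyG₂ :=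
  mainTheorem9_general volume mk_complex.le
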